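/- Let $d=2$, $\alpha>0$, $\epsilon>0$, let $\mathcal A=\{e_1,e_2,x\}\subset\mathbb R^2$ with $x=(1-\epsilon,8\alpha\epsilon)$, and let $\theta=e_1$. In each round $t=1,\dots,n$ a learner chooses $A_t\in\mathcal A$ (possibly at random) based on $A_1,Y_1,\dots,A_{t-1},Y_{t-1}$ and observes $Y_t=\langle A_t,\theta\rangle+\eta_t$ with independent noise $\eta_t\sim\mathcal N(0,1)$. An algorithm $\pi$ may depend on the horizon $n$. For a parameter $\theta'\in\mathbb R^2$ let $\Delta_y(\theta')=\max_{z\in\mathcal A}\langle z,\theta'\rangle-\langle y,\theta'\rangle$, $\Delta_y=\Delta_y(\theta)$, and let $R^\pi_{\theta'}(n)=\mathbb E_{\theta'}\big[\sum_{t=1}^n\Delta_{A_t}(\theta')\big]$ be the regret. The algorithm is consistent if $R^\pi_{\theta'}(n)=o(n^p)$ for all $\theta'\in\mathbb R^2$ and all $p>0$. It is optimistic, with confidence sets $\mathcal C_t\subseteq\mathbb R^2$ ($t\le n$) that are functions of $n$ and of $A_1,Y_1,\dots,A_{t-1},Y_{t-1}$, if in every round $$A_t\in\operatorname*{arg\,max}_{y\in\mathcal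 A}\ \sup_{\tilde\theta\in\mathcal C_t}\langle y,\tilde\theta\rangle .$$ Let $G_{t-1}=\sum_{s<t}A_sA_s^\top$, let $\hat\theta_{t-1}$ be a least squares estimate, that is, a solution of $G_{t-1}\hat\theta_{t-1}=\sum_{s<t}A_sY_s$, and let $$\mathcal E_t=\{\tilde\theta:(\hat\theta_{t-1}-\tilde\theta)^\top G_{t-1}(\hat\theta_{t-1}-\tilde\theta)\le\alpha\log n\},$$ which does not depend on the choice of the solution. Call $\pi$ admissible for $(\alpha,\epsilon)$ if it is consistent and optimistic with confidence sets such that $\mathcal C_t\subseteq\mathcal E_t$ for all $t\le n$ and $\mathbb P_\theta(\exists t\le n:\theta\notin\mathcal C_t)=O(1/n)$. Let $c(\mathcal A,\theta)$ be the infimum of $\sum_{y\in\mathcal A}w(y)\Delta_y$ over all $w\in[0,\infty)^{\mathcal A}$ for which $H(w)=\sum_{y\in\mathcal A}w(y)yy^\top$ is invertible and $y^\top H(w)^{-1}y\le\Delta_y^2/2$ for all $y\in\mathcal A$ with $\Delta_y>0$. Then: 1. For every $\alpha\ge\frac18$ there is $\epsilon_0>0$ such that $c(\mathcal A,\theta)=128\alpha^2$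 for all $\epsilon\in(0,\epsilon_0)$. 2. There is a universal constant $c_0>0$ such that for every $\alpha>0$ there is $\epsilon_0>0$ with the following property: for all $\epsilon\in(0,\epsilon_0)$ and every algorithm $\pi$ that is admissible for $(\alpha,\epsilon)$, $c(\mathcal A,\theta)=128\alpha^2$ and $$\limsup_{n\to\infty}\frac{R^\pi_\theta(n)}{\log n}\ \ge\ \frac{c_0}{\epsilon}.$$ 3. Optimism is therefore suboptimal by an arbitrarily large factor: for every $\alpha>0$ and $K>0$ there is $\epsilon_0>0$ such that for all $\epsilon\in(0,\epsilon_0)$ and every algorithm $\pi$ that is admissible for $(\alpha,\epsilon)$, $$\limsup_{n\to\infty}\frac{R^\pi_\theta(n)}{\log n}\ \ge\ K\,c(\mathcal A,\theta).$$ -/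

import Mathlib

open MeasureTheory ProbabilityTheory Filter Topology Asymptotics Matrix

namespace LinearBandit

noncomputable section

/-! Finite-armed linear bandits in `ℝ^d` with standard Gaussian noise. Vectors are functions
`Fin d → ℝ` and the inner product is the dot product `⬝ᵥ`. -/

/-- The sequence of the first `t` action-reward pairs. -/
abbrev History {d : ℕ} (A : Finset (Fin d → ℝ)) (t : ℕ) : Type := Fin t → A × ℝ

/-- A (possibly randomised) policy: the law of the next action, given the `t` previous
action-reward pairs. -/
structure Policy {d : ℕ} (A : Finset (Fin d → ℝ)) where
  next : (t : ℕ) → Kernel (History A t) A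
  isMarkov : ∀ t, IsMarkovKernel (next t)

/-- The law `N(⟨x, θ⟩, 1)` of the reward of the action `x`. -/
def rewardKernel {d : ℕ} (A : Finset (Fin d → ℝ)) (θ : Fin d → ℝ) : Kernel A ℝ :=
  Kernel.ofFunOfCountable fun x : A => gaussianReal (x.1 ⬝ᵥ θ) 1

/-- The law of the next action-reward pair, given the history. -/
def stepKernel {d : ℕ} {A : Finset (Fin d → ℝ)} (π : Policy A) (θ : Fin d → ℝ) (t : ℕ) :
    Kernel (History A t) (A × ℝ) :=
  π.next t ⊗ₖ Kernel.prodMkLeft (History A t) (rewardKernel A θ)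

/-- The law of the first `t` action-reward pairs, for the policy `π` and the parameter `θ`. -/
def law {d : ℕ} {A : Finset (Fin d → ℝ)} (π : Policy A) (θ : Fin d → ℝ) :
    (t : ℕ) → Measure (History A t)
  | 0 => Measure.dirac Fin.elim0
  | t + 1 => (law π θ t ⊗ₘ stepKernel π θ t).map fun p => Fin.snoc p.1 p.2

/-- The sub-optimality gap of the action `x`. -/
def gap {d : ℕ} (A : Finset (Fin d → ℝ)) (θ x : Fin d → ℝ) : ℝ :=
  (⨆ y : A, y.1 ⬝ᵥ θ) - x ⬝ᵥ θ

/-- The expected pseudo-regret over `n` rounds. -/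
def regret {d : ℕ} {A : Finset (Fin d → ℝ)} (π : Policy A) (θ : Fin d → ℝ) (n : ℕ) : ℝ :=
  ∫ h, ∑ s : Fin n, gap A θ (h s).1 ∂(law π θ n)

/-- An algorithm may use the horizon `n`, so it is a family of policies indexed by `n`. It is
consistent if its regret is `o(n^p)` for every parameter and every `p > 0`. -/
def IsConsistent {d : ℕ} {A : Finset (Fin d → ℝ)} (π : ℕ → Policy A) : Prop :=
  ∀ θ : Fin d → ℝ, ∀ p : ℝ, 0 < p →
    (fun n : ℕ => regret (π n) θ n) =o[atTop] fun n : ℕ => (n : ℝ) ^ p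

/-- A rule for confidence sets: at horizon `n`, the set used for choosing the action that follows
a history of `t` action-reward pairs. -/
abbrev ConfidenceSets {d : ℕ} (A : Finset (Fin d → ℝ)) : Type :=
  (n t : ℕ) → History A t → Set (Fin d → ℝ)

/-- The largest mean of the action `x` that the confidence set `S` allows (possibly `⊤`, if `S` is
unbounded). -/
def optimisticValue {d : ℕ} (S : Set (Fin d → ℝ)) (x : Fin d → ℝ) : EReal :=
  ⨆ θ' ∈ S, ((x ⬝ᵥ θ' : ℝ) : EReal)

/-- In every round the action maximises the optimistic value; ties are broken arbitrarily. -/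
def IsOptimistic {d : ℕ} {A : Finset (Fin d → ℝ)} (π : ℕ → Policy A) (C : ConfidenceSets A) :
    Prop :=
  ∀ n t : ℕ, t < n → ∀ h : History A t,
    ∀ᵐ x ∂((π n).next t h), ∀ y : A,
      optimisticValue (C n t h) y.1 ≤ optimisticValue (C n t h) x.1

/-- The Gram matrix of the actions in a history. -/
def gram {d : ℕ} {A : Finset (Fin d → ℝ)} {t : ℕ} (h : History A t) :
    Matrix (Fin d) (Fin d) ℝ :=
  ∑ s : Fin t, vecMulVec (h s).1.1 (h s).1.1

/-- Least squares estimates, as the solutions of the normal equations: there is exactly one if the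
Gram matrix is invertible. -/
def IsLeastSquares {d : ℕ} {A : Finset (Fin d → ℝ)} {t : ℕ} (h : History A t)
    (θhat : Fin d → ℝ) : Prop :=
  gram h *ᵥ θhat = ∑ s : Fin t, (h s).2 • (h s).1.1

/-- The ellipsoid of squared radius `r` about the least squares estimate, in the norm given by the
Gram matrix. If the Gram matrix is singular, then all least squares estimates, such as the one
given by the pseudo-inverse, define the same set. -/
def ellipsoid {d : ℕ} {A : Finset (Fin d → ℝ)} {t : ℕ} (h : History A t) (r : ℝ) :
    Set (Fin d → ℝ) :=
  {θ' | ∃ θhat, IsLeastSquares h θhat ∧ (θhat - θ') ⬝ᵥ (gram h *ᵥ (θhat - θ')) ≤ r}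

/-- The confidence sets lie in the least squares ellipsoids of squared radius `α log n`. -/
def WithinEllipsoids {d : ℕ} {A : Finset (Fin d → ℝ)} (C : ConfidenceSets A) (α : ℝ) : Prop :=
  ∀ n t : ℕ, t < n → ∀ h : History A t, C n t h ⊆ ellipsoid h (α * Real.log n)

/-- The probability that the confidence set of some round `t + 1 ≤ n` misses the parameter. -/
def failureProb {d : ℕ} {A : Finset (Fin d → ℝ)} (π : ℕ → Policy A) (C : ConfidenceSets A)
    (θ : Fin d → ℝ) (n : ℕ) : ℝ :=
  (law (π n) θ n).real
    {h | ∃ t : Fin n, θ ∉ C n t fun s : Fin (t : ℕ) => h (Fin.castLE t.isLt.le s)}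

/-- The matrix `H(w) = ∑ w(x) x xᵀ` of an allocation `w`. -/
def allocMatrix {d : ℕ} {A : Finset (Fin d → ℝ)} (w : A → ℝ) : Matrix (Fin d) (Fin d) ℝ :=
  ∑ x : A, w x • vecMulVec x.1 x.1

/-- The feasible allocations: `H(w)` is invertible and `‖x‖²_{H(w)⁻¹} ≤ Δ_x² / 2` for all
suboptimal actions `x`. -/
def feasible {d : ℕ} (A : Finset (Fin d → ℝ)) (θ : Fin d → ℝ) : Set (A → ℝ) :=
  {w | (∀ x, 0 ≤ w x) ∧ IsUnit (allocMatrix w) ∧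
    ∀ x : A, 0 < gap A θ x.1 →
      x.1 ⬝ᵥ ((allocMatrix w)⁻¹ *ᵥ x.1) ≤ gap A θ x.1 ^ 2 / 2}

/-- The value `c(A, θ)` of the optimisation problem (optimal actions have gap `0`, so they do not
contribute to the sum). -/
def optConst {d : ℕ} (A : Finset (Fin d → ℝ)) (θ : Fin d → ℝ) : EReal :=
  ⨅ w ∈ feasible A θ, ((∑ x : A, w x * gap A θ x.1 : ℝ) : EReal)

/-- The asymptotic regret `limsup R(n) / log n`. -/
def asympRegret {d : ℕ} {A : Finset (Fin d → ℝ)} (π : ℕ → Policy A) (θ : Fin d → ℝ) : EReal :=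
  limsup (fun n : ℕ => ((regret (π n) θ n / Real.log n : ℝ) : EReal)) atTop

/-- The action set `{e₁, e₂, (1 - ε, 8αε)}` in the plane. -/
def arms (α ε : ℝ) : Finset (Fin 2 → ℝ) :=
  {![1, 0], ![0, 1], ![1 - ε, 8 * α * ε]}

/-- The parameter `e₁`. -/
def e₁ : Fin 2 → ℝ := ![1, 0]

/-- The algorithms to which the result applies, on the actions `A` and with true parameter `θ`:
consistent and optimistic, with confidence sets in the ellipsoids of squared radius `α log n` and
with failure probability `O(1 / n)`. -/
def IsOptimisticAlgorithm {d : ℕ} {A : Finset (Fin d → ℝ)} (α : ℝ) (θ : Fin d → ℝ)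
    (π : ℕ → Policy A) : Prop :=
  IsConsistent π ∧ ∃ C : ConfidenceSets A, IsOptimistic π C ∧ WithinEllipsoids C α ∧
    (fun n : ℕ => failureProb π C θ n) =O[atTop] fun n : ℕ => 1 / (n : ℝ)

instance isProbabilityMeasure_law {d : ℕ} {A : Finset (Fin d → ℝ)} (π : Policy A)
    (θ : Fin d → ℝ) (t : ℕ) : IsProbabilityMeasure (law π θ t) := by
  induction t with
  | zero => unfold law; infer_instance
  | succ t ih =>
    have h1 := π.isMarkov t
    have h2 : IsMarkovKernel (rewardKernel A θ) :=
      ⟨fun x => (inferInstance : IsProbabilityMeasure (gaussianReal (x.1 ⬝ᵥ θ) 1))⟩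
    have h3 : IsMarkovKernel (stepKernel π θ t) := by unfold stepKernel; infer_instance
    unfold law
    refine Measure.isProbabilityMeasure_map (Measurable.aemeasurable ?_)
    refine measurable_pi_lambda _ fun i => ?_
    refine Fin.lastCases ?_ (fun j => ?_) i
    · simpa using measurable_snd
    · simp only [Fin.snoc_castSucc]
      exact (measurable_pi_apply j).comp measurable_fst

end

end LinearBandit

/-! Compare `e₁` with the alternative `(1, δ)`, where `α δ = 5/32`: there `x` has mean `1 + ε/4` and
beats the action `(1, 0)`. A consistent algorithm must tell the two parameters apart, which takes
information (Kullback-Leibler divergence) at least `3/4 log n` (`log_le_information`).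

The action `(1, 0)` gives none. The action `(0, 1)` gives `δ²/2` per play, but optimism soon
abandons it: while the confidence set contains the truth, `(1, 0)` has optimistic value at least
`1`, and `(0, 1)` after `T` plays at most `√(4α log n / T)`. So it is played at most `4α log n +
O(1)` times on average (`integral_actionCount_le`), for at most `25/64 log n + O(1)` of information.
The rest must come from `x`, which gives only `25/32 ε` per unit of regret, and the regret is of
order `log n / ε` (`eventually_le_regret`).

Without optimism, it is cheapest for small `ε` to buy all the information from `(0, 1)`, at a cost
free of `ε` (`optConst_arms`). Both halves use `α ≥ 1/8`; admissibility even forces `α ≥ 1`, because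
after one round the ellipsoid already misses the truth with probability at least a constant times `n
^ (-α)` (`one_le_of_isOptimisticAlgorithm`). -/

namespace LinearBandit

/-! ### Laws of histories and their marginals -/

section Law

variable {d : ℕ} {A : Finset (Fin d → ℝ)}

instance isMarkovKernel_next (π : Policy A) (t : ℕ) : IsMarkovKernel (π.next t) := π.isMarkov t

instance isMarkovKernel_rewardKernel (θ : Fin d → ℝ) : IsMarkovKernel (rewardKernel A θ) :=
  ⟨fun x => (inferInstance : IsProbabilityMeasure (gaussianReal (x.1 ⬝ᵥ θ) 1))⟩

instance isMarkovKernel_stepKernel (π : Policy A) (θ : Fin d → ℝ) (t : ℕ) :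
    IsMarkovKernel (stepKernel π θ t) := by
  unfold stepKernel; infer_instance

lemma rewardKernel_apply (θ : Fin d → ℝ) (a : A) :
    rewardKernel A θ a = gaussianReal (a.1 ⬝ᵥ θ) 1 := rfl

lemma measurable_snoc (t : ℕ) :
    Measurable fun p : History A t × (A × ℝ) =>
      (Fin.snoc p.1 p.2 : History A (t + 1)) := by
  refine measurable_pi_lambda _ fun i => ?_
  refine Fin.lastCases ?_ (fun j => ?_) i
  · simpa using measurable_snd
  · simp only [Fin.snoc_castSucc]
    exact (measurable_pi_apply j).comp measurable_fst

/-- Integration against the law of the first `t + 1` rounds, one round at a time. -/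
lemma lintegral_law_succ (π : Policy A) (θ : Fin d → ℝ) (t : ℕ)
    {g : History A (t + 1) → ENNReal} (hg : Measurable g) :
    ∫⁻ h, g h ∂(law π θ (t + 1)) =
      ∫⁻ h, ∫⁻ a, ∫⁻ y, g (Fin.snoc h (a, y)) ∂(gaussianReal (a.1 ⬝ᵥ θ) 1) ∂(π.next t h)
        ∂(law π θ t) := by
  have h1 : Measurable fun p : History A t × (A × ℝ) => g (Fin.snoc p.1 p.2) :=
    hg.comp (measurable_snoc t)
  rw [law, lintegral_map hg (measurable_snoc t), Measure.lintegral_compProd h1]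
  refine lintegral_congr fun h => ?_
  rw [stepKernel, Kernel.lintegral_compProd _ _ _
    (show Measurable fun p : A × ℝ => g (Fin.snoc h p) from h1.comp measurable_prodMk_left)]
  refine lintegral_congr fun a => ?_
  rw [Kernel.prodMkLeft_apply, rewardKernel_apply]

lemma law_succ_map_init (π : Policy A) (θ : Fin d → ℝ) (t : ℕ) :
    (law π θ (t + 1)).map (fun h (s : Fin t) => h s.castSucc) = law π θ t := by
  have hm : Measurable fun (h : History A (t + 1)) (s : Fin t) => h s.castSucc :=
    measurable_pi_lambda _ fun s => measurable_pi_apply _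
  refine Measure.ext_of_lintegral _ fun g hg => ?_
  rw [lintegral_map hg hm, lintegral_law_succ π θ t (g := fun h => g fun s => h s.castSucc) (hg.comp hm)]
  simp

/-- The laws of the histories of different lengths are compatible. -/
lemma law_map_castLE (π : Policy A) (θ : Fin d → ℝ) {t n : ℕ} (htn : t ≤ n) :
    (law π θ n).map (fun h (s : Fin t) => h (Fin.castLE htn s)) = law π θ t := by
  induction n, htn using Nat.le_induction with
  | base => simp
  | succ n htn ih =>
    rw [← ih, ← law_succ_map_init π θ n, Measure.map_map]
    · rfl
    · exact measurable_pi_lambda _ fun s => measurable_pi_apply _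
    · exact measurable_pi_lambda _ fun s => measurable_pi_apply _

/-- The law of the action-reward pair of a single round. -/
lemma exists_law_map_apply (π : Policy A) (θ : Fin d → ℝ) {n : ℕ} (s : Fin n) :
    ∃ ν : Measure A, IsProbabilityMeasure ν ∧
      (law π θ n).map (fun h => h s) = ν ⊗ₘ rewardKernel A θ := by
  refine ⟨(π.next s) ∘ₘ (law π θ s), inferInstance, ?_⟩
  have h1 : (fun h : History A n => h s) =
      (fun h : History A (s + 1) => h (Fin.last s)) ∘
        (fun h (r : Fin (s + 1)) => h (Fin.castLE s.isLt r)) := by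
    ext h <;> rfl
  have hm : Measurable fun (h : History A n) (r : Fin (s + 1)) => h (Fin.castLE s.isLt r) :=
    measurable_pi_lambda _ fun s => measurable_pi_apply _
  rw [h1, ← Measure.map_map (measurable_pi_apply _) hm, law_map_castLE]
  refine Measure.ext_of_lintegral _ fun g hg => ?_
  rw [lintegral_map hg (measurable_pi_apply _),
    lintegral_law_succ π θ s (g := fun h => g (h (Fin.last s)))
      (hg.comp (measurable_pi_apply _)),
    Measure.lintegral_compProd hg,
    Measure.lintegral_bind (Kernel.aemeasurable _) (Measurable.of_discrete).aemeasurable]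
  simp [rewardKernel_apply]

end Law

/-! ### Likelihood ratios and change of measure -/

section ChangeOfMeasure

variable {d : ℕ} {A : Finset (Fin d → ℝ)}

/-- Completing the square. The exponent is written in the centred noise `y - m`, so that its mean
under `N(m, 1)` is visibly `-(m' - m)² / 2`. -/
lemma gaussianReal_one_eq_withDensity (m m' : ℝ) :
    gaussianReal m' 1 = (gaussianReal m 1).withDensity
      fun y => ENNReal.ofReal (Real.exp ((m' - m) * (y - m) - (m' - m) ^ 2 / 2)) := by
  rw [gaussianReal_of_var_ne_zero _ one_ne_zero, gaussianReal_of_var_ne_zero _ one_ne_zero,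
    ← withDensity_mul _ (measurable_gaussianPDF _ _) (by fun_prop)]
  congr 1
  ext y
  rw [Pi.mul_apply, gaussianPDF, gaussianPDF,
    ← ENNReal.ofReal_mul (gaussianPDFReal_nonneg _ _ _), gaussianPDFReal, gaussianPDFReal,
    mul_assoc, mul_assoc, ← Real.exp_add]
  congr 3
  simp only [NNReal.coe_one]
  ring

/-- The logarithm of the likelihood ratio of `θ'` with respect to `θ`. -/
noncomputable def logLR (θ θ' : Fin d → ℝ) {t : ℕ} (h : History A t) : ℝ :=
  ∑ s : Fin t, (((h s).1.1 ⬝ᵥ (θ' - θ)) * ((h s).2 - (h s).1.1 ⬝ᵥ θ)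
    - ((h s).1.1 ⬝ᵥ (θ' - θ)) ^ 2 / 2)

lemma measurable_action_comp {β : Type*} [MeasurableSpace β] (f : A → β) {t : ℕ} (s : Fin t) :
    Measurable fun h : History A t => f (h s).1 :=
  (Measurable.of_discrete (f := f)).comp (measurable_fst.comp (measurable_pi_apply s))

lemma measurable_logLR (θ θ' : Fin d → ℝ) (t : ℕ) :
    Measurable (logLR θ θ' : History A t → ℝ) := by
  unfold logLR
  refine Finset.measurable_sum _ fun s _ => ?_
  have h1 := measurable_action_comp (A := A) (fun a => a.1 ⬝ᵥ (θ' - θ)) s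
  have h2 := measurable_action_comp (A := A) (fun a => a.1 ⬝ᵥ θ) s
  have h3 : Measurable fun h : History A t => (h s).2 :=
    measurable_snd.comp (measurable_pi_apply s)
  exact (h1.mul (h3.sub h2)).sub ((h1.pow_const 2).div_const 2)

/-- Change of measure between two parameters. -/
lemma lintegral_law_eq (π : Policy A) (θ θ' : Fin d → ℝ) (t : ℕ) :
    ∀ {g : History A t → ENNReal}, Measurable g →
      ∫⁻ h, g h ∂(law π θ' t) =
        ∫⁻ h, ENNReal.ofReal (Real.exp (logLR θ θ' h)) * g h ∂(law π θ t) := by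
  induction t with
  | zero => intro g hg; simp [law, logLR]
  | succ t ih =>
    intro g hg
    have hL : Measurable fun h : History A (t + 1) =>
        ENNReal.ofReal (Real.exp (logLR θ θ' h)) :=
      (Real.measurable_exp.comp (measurable_logLR θ θ' _)).ennreal_ofReal
    have h1 : Measurable fun p : (History A t × A) × ℝ => g (Fin.snoc p.1.1 (p.1.2, p.2)) :=
      (hg.comp (measurable_snoc t)).comp
        ((measurable_fst.comp measurable_fst).prodMk
          ((measurable_snd.comp measurable_fst).prodMk measurable_snd))
    have h2 : Measurable fun p : History A t × A =>
        ∫⁻ y, g (Fin.snoc p.1 (p.2, y)) ∂(gaussianReal (p.2.1 ⬝ᵥ θ') 1) :=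
      Measurable.lintegral_kernel_prod_right (κ := Kernel.prodMkLeft (History A t)
        (rewardKernel A θ')) h1
    rw [lintegral_law_succ π θ' t hg, lintegral_law_succ π θ t
      (g := fun h => ENNReal.ofReal (Real.exp (logLR θ θ' h)) * g h) (hL.mul hg), ih]
    · refine lintegral_congr fun h => ?_
      rw [← lintegral_const_mul _ (Measurable.of_discrete)]
      refine lintegral_congr fun a => ?_
      have hy : Measurable fun y : ℝ => g (Fin.snoc h (a, y)) :=
        h1.comp (measurable_prodMk_left (x := (h, a)))
      rw [gaussianReal_one_eq_withDensity (a.1 ⬝ᵥ θ) (a.1 ⬝ᵥ θ'),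
        lintegral_withDensity_eq_lintegral_mul _ (by fun_prop) hy,
        ← lintegral_const_mul _ (by fun_prop)]
      refine lintegral_congr fun y => ?_
      rw [Pi.mul_apply, ← mul_assoc, ← ENNReal.ofReal_mul (Real.exp_nonneg _), ← Real.exp_add]
      congr 3
      simp [logLR, Fin.sum_univ_castSucc, dotProduct_sub]
      ring
    · exact Measurable.lintegral_kernel_prod_right (κ := π.next t) h2

lemma law_apply_eq (π : Policy A) (θ θ' : Fin d → ℝ) (t : ℕ) {B : Set (History A t)}
    (hB : MeasurableSet B) :
    law π θ' t B = ∫⁻ h in B, ENNReal.ofReal (Real.exp (logLR θ θ' h)) ∂(law π θ t) := by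
  rw [← lintegral_indicator_one hB,
    lintegral_law_eq π θ θ' t (g := B.indicator 1) (measurable_one.indicator hB), ← lintegral_indicator hB]
  refine lintegral_congr fun h => ?_
  by_cases hh : h ∈ B <;> simp [hh]

/-- The noise of a round, scaled by a function of its action, has mean zero. -/
lemma integrable_and_integral_noise (π : Policy A) (θ : Fin d → ℝ) {n : ℕ} (s : Fin n)
    (c : A → ℝ) :
    Integrable (fun h : History A n => c (h s).1 * ((h s).2 - (h s).1.1 ⬝ᵥ θ)) (law π θ n) ∧
      ∫ h, c (h s).1 * ((h s).2 - (h s).1.1 ⬝ᵥ θ) ∂(law π θ n) = 0 := by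
  obtain ⟨ν, hν, h1⟩ := exists_law_map_apply π θ s
  let f : A × ℝ → ℝ := fun p => c p.1 * (p.2 - p.1.1 ⬝ᵥ θ)
  have hf : Measurable f :=
    ((Measurable.of_discrete (f := c)).comp measurable_fst).mul
      (measurable_snd.sub ((Measurable.of_discrete (f := fun a : A => a.1 ⬝ᵥ θ)).comp
        measurable_fst))
  have hid (m : ℝ) : Integrable (fun y : ℝ => y) (gaussianReal m 1) := by
    exact memLp_one_iff_integrable.1 (by exact_mod_cast memLp_id_gaussianReal (μ := m) (v := 1) 1)
  have h2 : Integrable f (ν ⊗ₘ rewardKernel A θ) := by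
    rw [Measure.integrable_compProd_iff hf.aestronglyMeasurable]
    refine ⟨ae_of_all _ fun a => ?_, Integrable.of_finite⟩
    exact ((hid (a.1 ⬝ᵥ θ)).sub (integrable_const (a.1 ⬝ᵥ θ))).const_mul (c a)
  have h3 : ∫ p, f p ∂(ν ⊗ₘ rewardKernel A θ) = 0 := by
    rw [Measure.integral_compProd h2]
    refine integral_eq_zero_of_ae (ae_of_all _ fun a => ?_)
    simp only [f, Pi.zero_apply, rewardKernel_apply]
    rw [integral_const_mul, integral_sub (hid _) (integrable_const _), integral_id_gaussianReal]
    simp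
  rw [← h1] at h2 h3
  have hm : AEMeasurable (fun h : History A n => h s) (law π θ n) :=
    (measurable_pi_apply s).aemeasurable
  rw [integral_map hm hf.aestronglyMeasurable] at h3
  exact ⟨h2.comp_aemeasurable hm, h3⟩

lemma integrable_action_comp (π : Policy A) (θ : Fin d → ℝ) {n : ℕ} (s : Fin n) (c : A → ℝ) :
    Integrable (fun h : History A n => c (h s).1) (law π θ n) := by
  refine Integrable.of_bound (measurable_action_comp c s).aestronglyMeasurable
    (∑ a, |c a|) (ae_of_all _ fun h => ?_)
  exact Finset.single_le_sum (f := fun a => |c a|) (fun a _ => abs_nonneg _) (Finset.mem_univ _)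

lemma integrable_sum_action (π : Policy A) (θ : Fin d → ℝ) (n : ℕ) (c : A → ℝ) :
    Integrable (fun h : History A n => ∑ s, c (h s).1) (law π θ n) :=
  integrable_finsetSum _ fun s _ => integrable_action_comp π θ s c

lemma integrable_logLR (π : Policy A) (θ θ' : Fin d → ℝ) (n : ℕ) :
    Integrable (logLR θ θ' : History A n → ℝ) (law π θ n) := by
  unfold logLR
  refine integrable_finsetSum _ fun s _ => ?_
  exact (integrable_and_integral_noise π θ s fun a => a.1 ⬝ᵥ (θ' - θ)).1.sub
    (integrable_action_comp π θ s fun a => (a.1 ⬝ᵥ (θ' - θ)) ^ 2 / 2)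

/-- The Kullback-Leibler divergence between the laws of the histories. -/
lemma integral_logLR (π : Policy A) (θ θ' : Fin d → ℝ) (n : ℕ) :
    ∫ h, logLR θ θ' h ∂(law π θ n) =
      -∫ h : History A n, ∑ s, ((h s).1.1 ⬝ᵥ (θ' - θ)) ^ 2 / 2 ∂(law π θ n) := by
  have h1 (s : Fin n) := integrable_and_integral_noise π θ s fun a => a.1 ⬝ᵥ (θ' - θ)
  have h2 (s : Fin n) := integrable_action_comp π θ s fun a => (a.1 ⬝ᵥ (θ' - θ)) ^ 2 / 2
  unfold logLR
  rw [integral_finsetSum _ fun s _ => by exact (h1 s).1.sub (h2 s),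
    integral_finsetSum _ fun s _ => h2 s, ← Finset.sum_neg_distrib]
  refine Finset.sum_congr rfl fun s _ => ?_
  rw [integral_sub (h1 s).1 (h2 s), (h1 s).2, zero_sub]

/-- A lower bound for the probability of an event under a change of measure. -/
lemma mul_exp_le_lintegral_exp {Ω : Type*} [MeasurableSpace Ω] (μ : Measure Ω)
    [IsProbabilityMeasure μ] {L : Ω → ℝ} (hL : Integrable L μ)
    (hexp : ∫⁻ x, ENNReal.ofReal (Real.exp (L x)) ∂μ = 1) {B : Set Ω} (hB : MeasurableSet B)
    (hpos : 0 < μ.real B) :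
    μ.real B * Real.exp (-((1 - ∫ x, L x ∂μ) / μ.real B)) ≤
      (∫⁻ x in B, ENNReal.ofReal (Real.exp (L x)) ∂μ).toReal := by
  have hint : Integrable (fun x => Real.exp (L x)) μ := by
    refine ⟨Real.continuous_exp.comp_aestronglyMeasurable hL.1, ?_⟩
    rw [hasFiniteIntegral_iff_ofReal (ae_of_all _ fun x => Real.exp_nonneg _), hexp]
    exact ENNReal.one_lt_top
  have hexp' : ∫ x, Real.exp (L x) ∂μ = 1 := by
    rw [integral_eq_lintegral_of_nonneg_ae (ae_of_all _ fun x => Real.exp_nonneg _) hint.1, hexp]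
    rfl
  rw [← integral_eq_lintegral_of_nonneg_ae (ae_of_all _ fun x => Real.exp_nonneg _)
    hint.1.restrict]
  -- Since `L ≤ exp L`, the complement of `B` contributes at most `1` to the mean of `L`.
  have h1 : ∫ x in Bᶜ, L x ∂μ ≤ 1 := by
    calc ∫ x in Bᶜ, L x ∂μ ≤ ∫ x in Bᶜ, Real.exp (L x) ∂μ :=
          setIntegral_mono hL.integrableOn hint.integrableOn fun x => by
            linarith [Real.add_one_le_exp (L x)]
      _ ≤ ∫ x, Real.exp (L x) ∂μ :=
          setIntegral_le_integral hint (ae_of_all _ fun x => Real.exp_nonneg _)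
      _ = 1 := hexp'
  have h2 := integral_add_compl hB hL
  -- Jensen on `B` through the tangent of `exp` at `c`. By the bound on the complement, `c` is at
  -- most the mean of `L` over `B`, so the linear term has a nonnegative integral.
  set c : ℝ := -((1 - ∫ x, L x ∂μ) / μ.real B) with hc
  have h3 : ∫ x in B, Real.exp c * (1 + (L x - c)) ∂μ ≤ ∫ x in B, Real.exp (L x) ∂μ := by
    refine setIntegral_mono ?_ hint.integrableOn fun x => ?_
    · exact (((integrable_const 1).add (hL.sub (integrable_const c))).const_mul _).integrableOn
    · have := Real.add_one_le_exp (L x - c)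
      calc Real.exp c * (1 + (L x - c)) ≤ Real.exp c * Real.exp (L x - c) := by
            gcongr; linarith
        _ = Real.exp (L x) := by rw [← Real.exp_add]; ring_nf
  refine le_trans ?_ h3
  have hLB : Integrable L (μ.restrict B) := hL.integrableOn
  rw [integral_const_mul, integral_add (integrable_const _) (by exact hLB.sub (integrable_const c)),
    integral_sub hLB (integrable_const _), mul_comm]
  simp only [integral_const, measureReal_restrict_apply_univ, smul_eq_mul, mul_one]
  have h4 : μ.real B * c = -(1 - ∫ x, L x ∂μ) := by rw [hc]; field_simp
  gcongr
  linarith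

end ChangeOfMeasure

/-! ### Optimism limits the exploration of suboptimal actions -/

section Optimism

variable {d : ℕ} {A : Finset (Fin d → ℝ)}

/-- The number of times the action `a` occurs in a history. -/
noncomputable def actionCount (a : A) {t : ℕ} (h : History A t) : ℝ :=
  ∑ s, ({a} : Set A).indicator (fun _ => (1 : ℝ)) (h s).1

lemma measurable_actionCount (a : A) (t : ℕ) :
    Measurable (actionCount a : History A t → ℝ) :=
  Finset.measurable_sum _ fun s _ => measurable_action_comp _ s

lemma dotProduct_gram_mulVec {t : ℕ} (h : History A t) (z : Fin d → ℝ) :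
    z ⬝ᵥ (gram h *ᵥ z) = ∑ s, ((h s).1.1 ⬝ᵥ z) ^ 2 := by
  rw [gram, Matrix.sum_mulVec, dotProduct_sum]
  refine Finset.sum_congr rfl fun s _ => ?_
  rw [vecMulVec_mulVec, dotProduct_smul, dotProduct_comm z]
  simp [sq]

/-- The two memberships may use different least squares estimates `u` and `v`, but these agree along
every played action, as `gram h` annihilates `u - v`. Then `(p + q)² ≤ 2p² + 2q²` gives the factor
`4`. -/
lemma sum_sq_le_of_mem_ellipsoid {t : ℕ} {h : History A t} {r : ℝ} {θ θ' : Fin d → ℝ}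
    (hθ : θ ∈ ellipsoid h r) (hθ' : θ' ∈ ellipsoid h r) :
    ∑ s, ((h s).1.1 ⬝ᵥ (θ' - θ)) ^ 2 ≤ 4 * r := by
  obtain ⟨u, hu, hur⟩ := hθ
  obtain ⟨v, hv, hvr⟩ := hθ'
  rw [dotProduct_gram_mulVec] at hur hvr
  have h0 : ∑ s, ((h s).1.1 ⬝ᵥ (u - v)) ^ 2 = 0 := by
    rw [← dotProduct_gram_mulVec, mulVec_sub, hu, hv, sub_self, dotProduct_zero]
  have h1 : ∀ s, (h s).1.1 ⬝ᵥ (u - v) = 0 := fun s =>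
    pow_eq_zero_iff two_ne_zero |>.1
      ((Finset.sum_eq_zero_iff_of_nonneg fun s _ => sq_nonneg _).1 h0 s (Finset.mem_univ s))
  calc ∑ s, ((h s).1.1 ⬝ᵥ (θ' - θ)) ^ 2
      ≤ ∑ s, (2 * ((h s).1.1 ⬝ᵥ (u - θ)) ^ 2 + 2 * ((h s).1.1 ⬝ᵥ (v - θ')) ^ 2) := by
        refine Finset.sum_le_sum fun s _ => ?_
        have := h1 s
        simp only [dotProduct_sub] at this ⊢
        rw [sub_eq_zero.1 this]
        nlinarith [sq_nonneg ((h s).1.1 ⬝ᵥ v - (h s).1.1 ⬝ᵥ θ +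
          ((h s).1.1 ⬝ᵥ v - (h s).1.1 ⬝ᵥ θ'))]
    _ ≤ 4 * r := by
        rw [Finset.sum_add_distrib, ← Finset.mul_sum, ← Finset.mul_sum]
        linarith

/-- An action that has been explored enough has a small optimistic value. -/
lemma optimisticValue_lt {t : ℕ} {h : History A t} {r : ℝ} {S : Set (Fin d → ℝ)}
    (hS : S ⊆ ellipsoid h r) {θ : Fin d → ℝ} (hθ : θ ∈ S) {a b : A} (hab : a.1 ⬝ᵥ θ < b.1 ⬝ᵥ θ)
    (hr : 0 ≤ r) (hcount : 4 * r < actionCount a h * (b.1 ⬝ᵥ θ - a.1 ⬝ᵥ θ) ^ 2) :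
    optimisticValue S a.1 < optimisticValue S b.1 := by
  have hΔ : 0 < b.1 ⬝ᵥ θ - a.1 ⬝ᵥ θ := sub_pos.2 hab
  have hN : 0 < actionCount a h := by
    by_contra hN
    have := mul_nonpos_of_nonpos_of_nonneg (not_lt.1 hN) (sq_nonneg (b.1 ⬝ᵥ θ - a.1 ⬝ᵥ θ))
    linarith
  have hb : ((b.1 ⬝ᵥ θ : ℝ) : EReal) ≤ optimisticValue S b.1 :=
    le_iSup₂ (f := fun (θ' : Fin d → ℝ) (_ : θ' ∈ S) => ((b.1 ⬝ᵥ θ' : ℝ) : EReal)) θ hθ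
  -- The plays of `a` alone account for `actionCount a h` equal terms of a sum of squares that is at
  -- most `4 * r`.
  have ha : optimisticValue S a.1 ≤
      ((a.1 ⬝ᵥ θ + √(4 * r / actionCount a h) : ℝ) : EReal) := by
    refine iSup₂_le fun θ' hθ' => ?_
    rw [EReal.coe_le_coe_iff, ← sub_le_iff_le_add', ← dotProduct_sub]
    refine Real.le_sqrt_of_sq_le ?_
    rw [le_div_iff₀ hN]
    refine le_trans ?_ (sum_sq_le_of_mem_ellipsoid (hS hθ) (hS hθ'))
    rw [actionCount, Finset.mul_sum]
    refine Finset.sum_le_sum fun s _ => ?_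
    by_cases hs : (h s).1 = a
    · simp [hs]
    · simpa [hs] using sq_nonneg _
  refine ha.trans_lt (lt_of_lt_of_le ?_ hb)
  rw [EReal.coe_lt_coe_iff, ← lt_sub_iff_add_lt', Real.sqrt_lt' hΔ, div_lt_iff₀ hN]
  linarith

lemma next_apply_singleton_eq_zero {π : ℕ → Policy A} {C : ConfidenceSets A} {α : ℝ}
    (hα : 0 ≤ α) (hopt : IsOptimistic π C) (hell : WithinEllipsoids C α) {n t : ℕ} (ht : t < n)
    {h : History A t} {θ : Fin d → ℝ} (hθ : θ ∈ C n t h) {a b : A}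
    (hab : a.1 ⬝ᵥ θ < b.1 ⬝ᵥ θ)
    (hcount : 4 * (α * Real.log n) / (b.1 ⬝ᵥ θ - a.1 ⬝ᵥ θ) ^ 2 < actionCount a h) :
    (π n).next t h {a} = 0 := by
  have hΔ : 0 < (b.1 ⬝ᵥ θ - a.1 ⬝ᵥ θ) ^ 2 := pow_pos (sub_pos.2 hab) 2
  have hlt := optimisticValue_lt (hell n t ht h) hθ hab
    (mul_nonneg hα (Real.log_natCast_nonneg n)) ((div_lt_iff₀ hΔ).1 hcount)
  have h1 : ∀ᵐ x ∂((π n).next t h), x ∉ ({a} : Set A) := by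
    filter_upwards [hopt n t ht h] with x hx hxa
    rw [Set.mem_singleton_iff] at hxa
    exact absurd (hx b) (not_le.2 (hxa ▸ hlt))
  simpa [ae_iff] using h1

/-- While `θ` is in the confidence set, an action explored beyond the threshold is almost surely not
chosen; playing it therefore requires a failure. -/
lemma law_explored_action_le {π : ℕ → Policy A} {C : ConfidenceSets A} {α : ℝ}
    (hα : 0 ≤ α) (hopt : IsOptimistic π C) (hell : WithinEllipsoids C α) {n : ℕ} (t : Fin n)
    {θ : Fin d → ℝ} {a b : A} (hab : a.1 ⬝ᵥ θ < b.1 ⬝ᵥ θ) :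
    (law (π n) θ n).real {h | (h t).1 = a ∧
      4 * (α * Real.log n) / (b.1 ⬝ᵥ θ - a.1 ⬝ᵥ θ) ^ 2 <
        actionCount a fun s : Fin (t : ℕ) => h (Fin.castLE t.isLt.le s)} ≤
      failureProb π C θ n := by
  set M := 4 * (α * Real.log n) / (b.1 ⬝ᵥ θ - a.1 ⬝ᵥ θ) ^ 2 with hM
  have hres (k : ℕ) (hk : k ≤ n) :
      Measurable fun (h : History A n) (s : Fin k) => h (Fin.castLE hk s) :=
    measurable_pi_lambda _ fun s => measurable_pi_apply _
  let U : Set (History A t) := {h | M < actionCount a h}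
  have hU : MeasurableSet U := measurableSet_lt measurable_const (measurable_actionCount a t)
  -- Confidence sets need not depend measurably on the history. Failure is therefore replaced by the
  -- measurable event that the policy gives `a` positive mass, which is contained in it once `a` is
  -- over-explored.
  let V : Set (History A t) := U ∩ {h | (π n).next t h {a} ≠ 0}
  have hV : MeasurableSet V := hU.inter
    ((Kernel.measurable_coe _ (measurableSet_singleton a)) (measurableSet_singleton 0).compl)
  let T : Set (History A (t + 1)) :=
    {h | (h (Fin.last t)).1 = a} ∩ (fun h (s : Fin (t : ℕ)) => h s.castSucc) ⁻¹' U
  have hT : MeasurableSet T := by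
    refine MeasurableSet.inter ?_ ((measurable_pi_lambda _ fun s => measurable_pi_apply _) hU)
    exact (measurable_fst.comp (measurable_pi_apply (Fin.last (t : ℕ))))
      (measurableSet_singleton a)
  have h1 : law (π n) θ (t + 1) T ≤ law (π n) θ t V := by
    rw [← lintegral_indicator_one hT, lintegral_law_succ _ _ _
      (g := T.indicator 1) (measurable_one.indicator hT), ← lintegral_indicator_one hV]
    refine lintegral_mono fun h => ?_
    have h2 : ∀ (x : A) (y : ℝ), T.indicator (1 : History A (t + 1) → ENNReal)
        (Fin.snoc h (x, y)) = ({a} : Set A).indicator (fun _ => U.indicator 1 h) x := by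
      intro x y
      by_cases hx : x = a <;> by_cases hh : h ∈ U <;> simp [T, hx, hh, Set.indicator]
    simp only [h2, lintegral_const, measure_univ, mul_one]
    rw [lintegral_indicator (measurableSet_singleton a), setLIntegral_const]
    by_cases hh : h ∈ U
    · by_cases h0 : (π n).next t h {a} = 0
      · simp [h0]
      · have : h ∈ V := ⟨hh, h0⟩
        simpa [this, hh] using prob_le_one
    · simp [hh]
  rw [failureProb, measureReal_def, measureReal_def]
  refine ENNReal.toReal_mono (measure_ne_top _ _) ?_
  calc law (π n) θ n {h | (h t).1 = a ∧
        M < actionCount a fun s : Fin (t : ℕ) => h (Fin.castLE t.isLt.le s)}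
      = law (π n) θ (t + 1) T := by
        rw [← law_map_castLE (π n) θ t.isLt, Measure.map_apply (hres _ _) hT]
        rfl
    _ ≤ law (π n) θ t V := h1
    _ = law (π n) θ n ((fun h (s : Fin t) => h (Fin.castLE t.isLt.le s)) ⁻¹' V) := by
        rw [← law_map_castLE (π n) θ t.isLt.le, Measure.map_apply (hres _ _) hV]
    _ ≤ _ := by
        refine measure_mono fun h hh => ⟨t, fun hθ => hh.2 ?_⟩
        exact next_apply_singleton_eq_zero hα hopt hell t.isLt hθ hab hh.1

/-- Pathwise: a play of `a` is either marked by an indicator or made when the count is at most `M`,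
which leaves the count at most `M + 1`. -/
lemma actionCount_le (a : A) {M : ℝ} (hM : 0 ≤ M) (n : ℕ) (h : History A n) :
    actionCount a h ≤ M + 1 + ∑ t : Fin n, {h : History A n | (h t).1 = a ∧
      M < actionCount a fun s : Fin (t : ℕ) => h (Fin.castLE t.isLt.le s)}.indicator
        (fun _ => (1 : ℝ)) h := by
  induction n with
  | zero => simp [actionCount]; linarith
  | succ n ih =>
    have ih' := ih fun s => h s.castSucc
    have h1 : actionCount a h = actionCount a (fun s : Fin n => h s.castSucc) +
        ({a} : Set A).indicator (fun _ => (1 : ℝ)) (h (Fin.last n)).1 := by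
      rw [actionCount, Fin.sum_univ_castSucc]; rfl
    have h2 : 0 ≤ ∑ t : Fin n, {h : History A n | (h t).1 = a ∧
        M < actionCount a fun s : Fin (t : ℕ) => h (Fin.castLE t.isLt.le s)}.indicator
          (fun _ => (1 : ℝ)) (fun s => h s.castSucc) :=
      Finset.sum_nonneg fun t _ => Set.indicator_nonneg (fun _ _ => zero_le_one) _
    rw [Fin.sum_univ_castSucc, h1, ← add_assoc]
    set w := {h : History A (n + 1) | (h (Fin.last n)).1 = a ∧
      M < actionCount a fun s : Fin (Fin.last n : ℕ) =>
        h (Fin.castLE (Fin.last n).isLt.le s)}.indicator (fun _ => (1 : ℝ)) h with hw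
    have hw0 : 0 ≤ w := Set.indicator_nonneg (fun _ _ => zero_le_one) _
    have h3 : ∀ t : Fin n, {h : History A (n + 1) | (h t.castSucc).1 = a ∧
        M < actionCount a fun s : Fin (t.castSucc : ℕ) =>
          h (Fin.castLE t.castSucc.isLt.le s)}.indicator (fun _ => (1 : ℝ)) h =
        {h : History A n | (h t).1 = a ∧
        M < actionCount a fun s : Fin (t : ℕ) => h (Fin.castLE t.isLt.le s)}.indicator
          (fun _ => (1 : ℝ)) (fun s => h s.castSucc) := fun t => rfl
    simp only [h3]
    by_cases hl : (h (Fin.last n)).1 = a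
    · have h4 : ({a} : Set A).indicator (fun _ => (1 : ℝ)) (h (Fin.last n)).1 = 1 := by simp [hl]
      rw [h4]
      by_cases hc : M < actionCount a fun s : Fin n => h s.castSucc
      · have : w = 1 := by
          rw [hw, Set.indicator_of_mem]; exact ⟨hl, hc⟩
        linarith
      · linarith
    · have h4 : ({a} : Set A).indicator (fun _ => (1 : ℝ)) (h (Fin.last n)).1 = 0 := by simp [hl]
      linarith

/-- An optimistic algorithm explores a suboptimal action at most logarithmically often. -/
lemma integral_actionCount_le {π : ℕ → Policy A} {C : ConfidenceSets A} {α : ℝ}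
    (hα : 0 ≤ α) (hopt : IsOptimistic π C) (hell : WithinEllipsoids C α) (n : ℕ)
    {θ : Fin d → ℝ} {a b : A} (hab : a.1 ⬝ᵥ θ < b.1 ⬝ᵥ θ) :
    ∫ h, actionCount a h ∂(law (π n) θ n) ≤
      4 * (α * Real.log n) / (b.1 ⬝ᵥ θ - a.1 ⬝ᵥ θ) ^ 2 + 1 + n * failureProb π C θ n := by
  set M := 4 * (α * Real.log n) / (b.1 ⬝ᵥ θ - a.1 ⬝ᵥ θ) ^ 2 with hM
  have hM0 : 0 ≤ M := by
    have := Real.log_natCast_nonneg n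
    positivity
  have hmeas (t : Fin n) : MeasurableSet {h : History A n | (h t).1 = a ∧
      M < actionCount a fun s : Fin (t : ℕ) => h (Fin.castLE t.isLt.le s)} := by
    have h1 : Measurable fun h : History A n =>
        actionCount a fun s : Fin (t : ℕ) => h (Fin.castLE t.isLt.le s) :=
      (measurable_actionCount a t).comp
        (measurable_pi_lambda _ fun s => measurable_pi_apply _)
    exact MeasurableSet.inter ((measurable_fst.comp (measurable_pi_apply t))
      (measurableSet_singleton a)) (measurableSet_lt measurable_const h1)
  have hint (t : Fin n) := (integrable_const (μ := law (π n) θ n) (1 : ℝ)).indicator (hmeas t)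
  calc ∫ h, actionCount a h ∂(law (π n) θ n)
      ≤ ∫ h, (M + 1 + ∑ t : Fin n, {h : History A n | (h t).1 = a ∧
          M < actionCount a fun s : Fin (t : ℕ) => h (Fin.castLE t.isLt.le s)}.indicator
            (fun _ => (1 : ℝ)) h) ∂(law (π n) θ n) := by
        refine integral_mono (integrable_sum_action _ _ _ _)
          ((integrable_const _).add (integrable_finsetSum _ fun t _ => hint t)) ?_
        exact fun h => actionCount_le a hM0 n h
    _ = M + 1 + ∑ t : Fin n, (law (π n) θ n).real {h : History A n | (h t).1 = a ∧
          M < actionCount a fun s : Fin (t : ℕ) => h (Fin.castLE t.isLt.le s)} := by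
        rw [integral_add (integrable_const _) (integrable_finsetSum _ fun t _ => hint t),
          integral_finsetSum _ fun t _ => hint t]
        congr 1
        · simp
        · refine Finset.sum_congr rfl fun t _ => ?_
          rw [integral_indicator (hmeas t)]
          simp
    _ ≤ M + 1 + ∑ t : Fin n, failureProb π C θ n := by
        gcongr with t
        exact law_explored_action_le hα hopt hell t hab
    _ = M + 1 + n * failureProb π C θ n := by simp

end Optimism

/-! ### Consistency forces logarithmic information -/

section Information

variable {d : ℕ} {A : Finset (Fin d → ℝ)}

lemma gap_nonneg (θ : Fin d → ℝ) (a : A) : 0 ≤ gap A θ a.1 :=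
  sub_nonneg.2 (le_ciSup (f := fun y : A => y.1 ⬝ᵥ θ) (Set.finite_range _).bddAbove a)

lemma mul_measureReal_le_regret (π : Policy A) (θ : Fin d → ℝ) (n : ℕ) {B : Set (History A n)}
    {c : ℝ} (hB : ∀ h ∈ B, c ≤ ∑ s, gap A θ (h s).1) (hc : 0 ≤ c) :
    c * (law π θ n).real B ≤ regret π θ n := by
  refine le_trans ?_ (mul_meas_ge_le_integral_of_nonneg (ae_of_all _ fun h =>
    Finset.sum_nonneg fun s _ => gap_nonneg θ _)
    (integrable_sum_action π θ n fun a => gap A θ a.1) c)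
  exact mul_le_mul_of_nonneg_left (measureReal_mono hB) hc

lemma regret_le_exp_of_isConsistent {π : ℕ → Policy A} (hπ : IsConsistent π) (θ : Fin d → ℝ)
    {p : ℝ} (hp : 0 < p) :
    ∀ᶠ n : ℕ in atTop, regret (π n) θ n ≤ Real.exp (p * Real.log n) := by
  filter_upwards [(hπ θ p hp).bound one_pos, eventually_gt_atTop 0] with n hn hn0
  have h1 : (n : ℝ) ^ p = Real.exp (p * Real.log n) := by
    rw [Real.rpow_def_of_pos (by exact_mod_cast hn0), mul_comm]
  rw [one_mul, h1, Real.norm_eq_abs, Real.norm_eq_abs, Real.abs_exp] at hn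
  exact (le_abs_self _).trans hn

/-- A consistent algorithm collects logarithmic information about the alternative parameters for
which the optimal action `a` is suboptimal. -/
lemma log_le_information {π : ℕ → Policy A} (hπ : IsConsistent π) {θ θ' : Fin d → ℝ} {a : A}
    {m : ℝ} (hm : 0 < m) (hθ : ∀ b : A, b ≠ a → m ≤ gap A θ b.1) (hθ' : m ≤ gap A θ' a.1) :
    ∀ᶠ n : ℕ in atTop, 3 / 4 * Real.log n ≤
      ∫ h : History A n, ∑ s, ((h s).1.1 ⬝ᵥ (θ' - θ)) ^ 2 / 2 ∂(law (π n) θ n) := by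
  have hlog : Tendsto (fun n : ℕ => Real.log n) atTop atTop :=
    Real.tendsto_log_atTop.comp tendsto_natCast_atTop_atTop
  filter_upwards [regret_le_exp_of_isConsistent hπ θ (p := 1 / 16) (by norm_num),
    regret_le_exp_of_isConsistent hπ θ' (p := 1 / 16) (by norm_num), eventually_gt_atTop 0,
    hlog.eventually_gt_atTop (112 / 9 * (Real.log (16 / (7 * m)) + 8 / 7)),
    hlog.eventually_gt_atTop (16 / 15 * Real.log (16 / m))] with n h1 h2 hn0 hL1 hL2
  set L := Real.log n with hL
  have hn : (n : ℝ) = Real.exp L := (Real.exp_log (by exact_mod_cast hn0)).symm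
  -- Under `θ` the complement of `B` costs regret at least `m n / 2`, and under `θ'` so does `B`.
  -- With regret at most `n ^ (1/16)`, both have probability at most `(2/m) n ^ (-15/16)`.
  set B : Set (History A n) := {h | (n : ℝ) / 2 ≤ actionCount a h} with hBdef
  have hB : MeasurableSet B := measurableSet_le measurable_const (measurable_actionCount a n)
  have hc : 0 ≤ m * n / 2 := by positivity
  have key : ∀ x : ℝ, m * n / 2 * x ≤ Real.exp (1 / 16 * L) →
      x ≤ 2 / m * Real.exp (-(15 / 16) * L) := by
    intro x hx
    have h3 : Real.exp (1 / 16 * L) = Real.exp L * Real.exp (-(15 / 16) * L) := by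
      rw [← Real.exp_add]; ring_nf
    rw [h3, hn] at hx
    have h4 : Real.exp L * (m / 2 * x) ≤ Real.exp L * Real.exp (-(15 / 16) * L) := by
      linarith
    have h5 := le_of_mul_le_mul_left h4 (Real.exp_pos L)
    rw [div_mul_eq_mul_div, le_div_iff₀ hm]
    linarith
  have hcompl : (law (π n) θ n).real Bᶜ ≤ 2 / m * Real.exp (-(15 / 16) * L) := by
    refine key _ ((mul_measureReal_le_regret (π n) θ n (fun h hh => ?_) hc).trans h1)
    have hh' : actionCount a h < n / 2 := not_le.1 hh
    calc m * n / 2 ≤ m * (n - actionCount a h) := by nlinarith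
      _ = ∑ s : Fin n, m * (1 - ({a} : Set A).indicator (fun _ => (1 : ℝ)) (h s).1) := by
          rw [actionCount, ← Finset.mul_sum, Finset.sum_sub_distrib]; simp
      _ ≤ ∑ s, gap A θ (h s).1 := by
          refine Finset.sum_le_sum fun s _ => ?_
          by_cases hs : (h s).1 = a
          · simpa [hs] using gap_nonneg θ a
          · simpa [hs] using hθ _ hs
  have hBle : (law (π n) θ' n).real B ≤ 2 / m * Real.exp (-(15 / 16) * L) := by
    refine key _ ((mul_measureReal_le_regret (π n) θ' n (fun h hh => ?_) hc).trans h2)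
    calc m * n / 2 ≤ m * actionCount a h := by
          have : (n : ℝ) / 2 ≤ actionCount a h := hh
          nlinarith
      _ ≤ ∑ s, gap A θ' (h s).1 := by
          rw [actionCount, Finset.mul_sum]
          refine Finset.sum_le_sum fun s _ => ?_
          by_cases hs : (h s).1 = a
          · simpa [hs] using hθ'
          · simpa [hs] using gap_nonneg θ' (h s).1
  have hsmall : 2 / m * Real.exp (-(15 / 16) * L) ≤ 1 / 8 := by
    have h3 : Real.exp (-(15 / 16) * L) ≤ Real.exp (-Real.log (16 / m)) :=
      Real.exp_le_exp.2 (by linarith)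
    rw [Real.exp_neg, Real.exp_log (by positivity)] at h3
    calc 2 / m * Real.exp (-(15 / 16) * L) ≤ 2 / m * (16 / m)⁻¹ := by gcongr
      _ = 1 / 8 := by field_simp; norm_num
  have hBge : 7 / 8 ≤ (law (π n) θ n).real B := by
    have := probReal_add_probReal_compl (μ := law (π n) θ n) hB
    linarith
  set K := ∫ h : History A n, ∑ s, ((h s).1.1 ⬝ᵥ (θ' - θ)) ^ 2 / 2 ∂(law (π n) θ n) with hK
  have hK0 : 0 ≤ K := integral_nonneg fun h => Finset.sum_nonneg fun s _ => by positivity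
  have hone : ∫⁻ h : History A n, ENNReal.ofReal (Real.exp (logLR θ θ' h)) ∂(law (π n) θ n) = 1 := by
    have := law_apply_eq (π n) θ θ' n MeasurableSet.univ
    rw [measure_univ, setLIntegral_univ] at this
    exact this.symm
  have hmain := mul_exp_le_lintegral_exp (law (π n) θ n) (integrable_logLR (π n) θ θ' n) hone hB
    (by linarith)
  rw [← law_apply_eq (π n) θ θ' n hB, ← measureReal_def, integral_logLR, ← hK] at hmain
  -- The change of measure gives `8/7 (1 + K) ≥ 15/16 L - log (16 / (7m))`. As `7/8 * 15/16 > 3/4`,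
  -- this contradicts `K < 3/4 L` for large `L`; the factor `112/9` is the inverse of `15/16 - 6/7`.
  by_contra hlt
  have h3 : (1 - -K) / (law (π n) θ n).real B ≤ 8 / 7 * (1 + K) := by
    rw [div_le_iff₀ (by linarith)]
    nlinarith
  have h4 : 7 / 8 * Real.exp (-(8 / 7 * (1 + K))) ≤ 2 / m * Real.exp (-(15 / 16) * L) :=
    calc 7 / 8 * Real.exp (-(8 / 7 * (1 + K)))
        ≤ (law (π n) θ n).real B * Real.exp (-((1 - -K) / (law (π n) θ n).real B)) := by
          gcongr
      _ ≤ _ := hmain.trans hBle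
  have h5 : Real.exp (-(8 / 7 * (1 + K))) ≤
      Real.exp (Real.log (16 / (7 * m)) + -(15 / 16) * L) := by
    rw [Real.exp_add, Real.exp_log (by positivity)]
    calc Real.exp (-(8 / 7 * (1 + K)))
        = 8 / 7 * (7 / 8 * Real.exp (-(8 / 7 * (1 + K)))) := by ring
      _ ≤ 8 / 7 * (2 / m * Real.exp (-(15 / 16) * L)) := by gcongr
      _ = 16 / (7 * m) * Real.exp (-(15 / 16) * L) := by field_simp; norm_num
  have h6 := Real.exp_le_exp.1 h5
  linarith

end Information

/-! ### Failure after one round, and the lower bound on `α` -/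

section FirstRound

variable {d : ℕ} {A : Finset (Fin d → ℝ)}

/-- With one observation, least squares reproduces the reward exactly along the played action, so
the ellipsoid is a slab around it. -/
lemma sq_le_of_mem_ellipsoid_one {h : History A 1} {r : ℝ} {θ : Fin d → ℝ}
    (ha : (h 0).1.1 ≠ 0) (hθ : θ ∈ ellipsoid h r) :
    ((h 0).2 - (h 0).1.1 ⬝ᵥ θ) ^ 2 ≤ r := by
  obtain ⟨u, hu, hur⟩ := hθ
  rw [dotProduct_gram_mulVec, Fin.sum_univ_one, dotProduct_sub] at hur
  rw [IsLeastSquares, gram, Fin.sum_univ_one, Fin.sum_univ_one, vecMulVec_mulVec] at hu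
  have h1 : (h 0).1.1 ⬝ᵥ u = (h 0).2 := by
    have := congrArg (fun v => (h 0).1.1 ⬝ᵥ v) hu
    simp only [op_smul_eq_smul, dotProduct_smul, smul_eq_mul] at this
    exact mul_right_cancel₀ (fun h0 => ha (dotProduct_self_eq_zero.1 h0)) this
  rwa [h1] at hur

/-- On the unit interval to the right of `√c` the density is at least its value at `√c + 1`, and
`(√c + 1)² / 2 ≤ c + 1`. The true decay rate is `c / 2`; the cruder rate suffices. -/
lemma exp_le_gaussianReal_sq_gt {c : ℝ} (hc : 0 ≤ c) :
    (√(2 * Real.pi))⁻¹ * Real.exp (-c - 1) ≤ (gaussianReal 0 1).real {y | c < y ^ 2} := by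
  set k := (√(2 * Real.pi))⁻¹ * Real.exp (-c - 1) with hk
  have h1 : Set.Ioc (√c) (√c + 1) ⊆ {y | c < y ^ 2} := fun y hy =>
    (Real.sqrt_lt' (lt_of_le_of_lt (Real.sqrt_nonneg c) hy.1)).1 hy.1
  have h2 : ENNReal.ofReal k ≤ gaussianReal 0 1 {y | c < y ^ 2} := by
    calc ENNReal.ofReal k = ∫⁻ _ in Set.Ioc (√c) (√c + 1), ENNReal.ofReal k := by
          rw [setLIntegral_const]; simp
      _ ≤ ∫⁻ y in Set.Ioc (√c) (√c + 1), gaussianPDF 0 1 y := by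
          refine setLIntegral_mono (measurable_gaussianPDF 0 1) fun y hy => ?_
          refine ENNReal.ofReal_le_ofReal ?_
          rw [gaussianPDFReal, hk]
          simp only [NNReal.coe_one, mul_one, sub_zero]
          gcongr
          have h3 := Real.sq_sqrt hc
          have h4 := Real.sqrt_nonneg c
          nlinarith [hy.1, hy.2, sq_nonneg (√c - 1)]
      _ = gaussianReal 0 1 (Set.Ioc (√c) (√c + 1)) :=
          (gaussianReal_apply 0 one_ne_zero _).symm
      _ ≤ _ := measure_mono h1
  rw [measureReal_def]
  exact (ENNReal.ofReal_le_iff_le_toReal (measure_ne_top _ _)).1 h2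

/-- After the first round, the ellipsoid misses the parameter with polynomial probability. -/
lemma gaussianReal_le_failureProb {π : ℕ → Policy A} {C : ConfidenceSets A} {α : ℝ}
    (hell : WithinEllipsoids C α) (hA : ∀ a ∈ A, a ≠ 0) (θ : Fin d → ℝ) {n : ℕ} (hn : 1 < n) :
    (gaussianReal 0 1).real {y | α * Real.log n < y ^ 2} ≤ failureProb π C θ n := by
  obtain ⟨ν, hν, h1⟩ := exists_law_map_apply (π n) θ (⟨0, hn.pos⟩ : Fin n)
  set c := α * Real.log n with hc
  let S : Set (A × ℝ) := {p | c < (p.2 - p.1.1 ⬝ᵥ θ) ^ 2}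
  have hS : MeasurableSet S := by
    refine measurableSet_lt measurable_const ((measurable_snd.sub ?_).pow_const 2)
    exact (Measurable.of_discrete (f := fun a : A => a.1 ⬝ᵥ θ)).comp measurable_fst
  have hS' : MeasurableSet {y : ℝ | c < y ^ 2} := measurableSet_lt measurable_const (by fun_prop)
  have h2 : (ν ⊗ₘ rewardKernel A θ) S = gaussianReal 0 1 {y | c < y ^ 2} := by
    rw [Measure.compProd_apply hS]
    have h3 : ∀ a : A, rewardKernel A θ a (Prod.mk a ⁻¹' S) =
        gaussianReal 0 1 {y | c < y ^ 2} := by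
      intro a
      have h4 := gaussianReal_map_sub_const (μ := a.1 ⬝ᵥ θ) (v := 1) (a.1 ⬝ᵥ θ)
      rw [sub_self] at h4
      rw [← h4, Measure.map_apply (by fun_prop) hS', rewardKernel_apply]
      rfl
    simp [h3]
  rw [← h1, Measure.map_apply (f := fun h : History A n => h ⟨0, hn.pos⟩)
    (measurable_pi_apply _) hS] at h2
  rw [failureProb, measureReal_def, measureReal_def, ← h2]
  refine ENNReal.toReal_mono (measure_ne_top _ _) (measure_mono fun h hh => ?_)
  refine ⟨⟨1, hn⟩, fun hθ => not_le.2 (show c < _ from hh) ?_⟩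
  exact sq_le_of_mem_ellipsoid_one (hA _ (h ⟨0, hn.pos⟩).1.2) (hell n 1 hn _ hθ)

/-- The failure probability of an admissible algorithm cannot decay too fast. -/
lemma one_le_of_isOptimisticAlgorithm {α : ℝ} (hα : 0 ≤ α) (hA : ∀ a ∈ A, a ≠ 0)
    {θ : Fin d → ℝ} {π : ℕ → Policy A} (hπ : IsOptimisticAlgorithm α θ π) : 1 ≤ α := by
  obtain ⟨-, C, -, hell, hfail⟩ := hπ
  by_contra! hα1
  obtain ⟨c, hc, hbound⟩ := hfail.exists_pos
  have hlog : Tendsto (fun n : ℕ => Real.log n) atTop atTop :=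
    Real.tendsto_log_atTop.comp tendsto_natCast_atTop_atTop
  set k := (√(2 * Real.pi))⁻¹ with hk
  have hk0 : 0 < k := by positivity
  obtain ⟨n, h1, hn, hL⟩ := (hbound.bound.and ((eventually_gt_atTop 1).and
    (hlog.eventually_gt_atTop ((Real.log (c / k) + 1) / (1 - α))))).exists
  set L := Real.log n with hLdef
  have hn0 : (0 : ℝ) < n := by exact_mod_cast hn.pos
  have hnL : (n : ℝ) = Real.exp L := (Real.exp_log hn0).symm
  have h2 := (exp_le_gaussianReal_sq_gt (mul_nonneg hα (Real.log_natCast_nonneg n))).trans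
    (gaussianReal_le_failureProb (π := π) hell hA θ hn)
  have h3 : k * Real.exp (-(α * L) - 1) ≤ c * Real.exp (-L) := by
    refine h2.trans ((le_abs_self _).trans ?_)
    rwa [Real.norm_eq_abs, Real.norm_eq_abs, abs_of_pos (by positivity : 0 < 1 / (n : ℝ)), hnL,
      one_div, ← Real.exp_neg] at h1
  have h4 : Real.exp (-(α * L) - 1) ≤ Real.exp (Real.log (c / k) + -L) := by
    rw [Real.exp_add, Real.exp_log (by positivity), div_mul_eq_mul_div, le_div_iff₀ hk0]
    linarith
  have h5 := Real.exp_le_exp.1 h4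
  rw [div_lt_iff₀ (by linarith)] at hL
  linarith

end FirstRound

/-! ### The three-armed instance and its regret -/

section Instance

variable {α ε : ℝ}

lemma mem_arms {a : Fin 2 → ℝ} :
    a ∈ arms α ε ↔ a = ![1, 0] ∨ a = ![0, 1] ∨ a = ![1 - ε, 8 * α * ε] := by
  simp [arms]

/-- The optimal action. -/
def arm₁ (α ε : ℝ) : arms α ε := ⟨![1, 0], mem_arms.2 (Or.inl rfl)⟩

/-- The informative action. -/
def arm₂ (α ε : ℝ) : arms α ε := ⟨![0, 1], mem_arms.2 (Or.inr (Or.inl rfl))⟩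

/-- The nearly optimal action. -/
def arm₃ (α ε : ℝ) : arms α ε := ⟨![1 - ε, 8 * α * ε], mem_arms.2 (Or.inr (Or.inr rfl))⟩

lemma eq_arm_cases (a : arms α ε) : a = arm₁ α ε ∨ a = arm₂ α ε ∨ a = arm₃ α ε := by
  simp only [Subtype.ext_iff]
  exact mem_arms.1 a.2

lemma arm₁_ne_arm₂ : arm₁ α ε ≠ arm₂ α ε := fun h => by
  have := congrFun (congrArg Subtype.val h) 0
  simp [arm₁, arm₂] at this

lemma arm₁_ne_arm₃ (hε : 0 < ε) : arm₁ α ε ≠ arm₃ α ε := fun h => by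
  have := congrFun (congrArg Subtype.val h) 0
  simp [arm₁, arm₃] at this
  linarith

lemma arm₂_ne_arm₃ (hε : ε < 1) : arm₂ α ε ≠ arm₃ α ε := fun h => by
  have := congrFun (congrArg Subtype.val h) 0
  simp [arm₂, arm₃] at this
  linarith

lemma sum_arms (hε : 0 < ε) (hε1 : ε < 1) {M : Type*} [AddCommMonoid M] (f : arms α ε → M) :
    ∑ a, f a = f (arm₁ α ε) + (f (arm₂ α ε) + f (arm₃ α ε)) := by
  classical
  have h : (Finset.univ : Finset (arms α ε)) = {arm₁ α ε, arm₂ α ε, arm₃ α ε} := by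
    ext a
    simpa using eq_arm_cases a
  rw [h, Finset.sum_insert (by simp [arm₁_ne_arm₂, arm₁_ne_arm₃ hε]),
    Finset.sum_insert (by simp [arm₂_ne_arm₃ hε1]), Finset.sum_singleton]

lemma gap_arms (hε : 0 < ε) (a : Fin 2 → ℝ) : gap (arms α ε) e₁ a = 1 - a 0 := by
  have hdot : ∀ b : Fin 2 → ℝ, b ⬝ᵥ e₁ = b 0 := fun b => by
    simp [e₁, dotProduct, Fin.sum_univ_two]
  simp only [gap, hdot]
  congr 1
  have : Nonempty (arms α ε) := ⟨arm₁ α ε⟩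
  refine le_antisymm (ciSup_le fun b => ?_)
    (le_ciSup (f := fun y : arms α ε => y.1 0) (Set.finite_range _).bddAbove (arm₁ α ε))
  obtain rfl | rfl | rfl := eq_arm_cases b <;> simp [arm₁, arm₂, arm₃]
  exact hε.le

/-- The regret lower bound on the instance. -/
lemma eventually_le_regret (hα : 1 / 8 ≤ α) (hε : 0 < ε) (hε1 : ε < 1)
    {π : ℕ → Policy (arms α ε)} (hπ : IsOptimisticAlgorithm α e₁ π) :
    ∀ᶠ n : ℕ in atTop, 1 / 4 / ε ≤ regret (π n) e₁ n / Real.log n := by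
  have hα0 : 0 < α := by linarith
  obtain ⟨hcons, C, hopt, hell, hfail⟩ := hπ
  obtain ⟨c, hc, hbound⟩ := hfail.exists_pos
  have hlog : Tendsto (fun n : ℕ => Real.log n) atTop atTop :=
    Real.tendsto_log_atTop.comp tendsto_natCast_atTop_atTop
  -- Any `δ > 1 / (8α)` makes `x` better than `(1, 0)`. Here `8αδ = 5/4`, for a margin of `ε / 4`,
  -- while `(0, 1)` still supplies too little information.
  set δ : ℝ := 5 / (32 * α) with hδ
  set θ' : Fin 2 → ℝ := ![1, δ] with hθ'
  have hαδ : α * δ = 5 / 32 := by rw [hδ]; field_simp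
  have hsub : ∀ a : Fin 2 → ℝ, a ⬝ᵥ (θ' - e₁) = a 1 * δ := fun a => by
    simp [hθ', e₁, dotProduct, Fin.sum_univ_two]
  have hinfo := log_le_information hcons (θ := e₁) (θ' := θ') (a := arm₁ α ε) (m := ε / 4)
    (by positivity) (fun b hb => by
      rw [gap_arms hε]
      obtain rfl | rfl | rfl := eq_arm_cases b
      · exact absurd rfl hb
      · simp [arm₂]; linarith
      · simp [arm₃]; linarith) (by
      have h1 := gap_nonneg θ' (arm₃ α ε)
      have h2 : (arm₃ α ε).1 ⬝ᵥ θ' - (arm₁ α ε).1 ⬝ᵥ θ' = ε / 4 := by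
        simp [arm₁, arm₃, hθ', dotProduct, Fin.sum_univ_two]
        linear_combination (8 * ε) * hαδ
      simp only [gap] at h1 ⊢
      linarith)
  filter_upwards [hinfo, hbound.bound, eventually_gt_atTop 0, hlog.eventually_gt_atTop 0,
    hlog.eventually_gt_atTop (10 * (δ ^ 2 / 2 * (1 + c)))] with n h1 h2 hn hL0 hL
  set L := Real.log n with hLdef
  set R := regret (π n) e₁ n with hR
  set N := ∫ h, actionCount (arm₂ α ε) h ∂(law (π n) e₁ n) with hN
  have hn0 : (0 : ℝ) < n := by exact_mod_cast hn
  have hF : n * failureProb π C e₁ n ≤ c := by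
    rw [Real.norm_eq_abs, Real.norm_eq_abs, abs_of_pos (by positivity : 0 < 1 / (n : ℝ))] at h2
    have := (le_abs_self _).trans h2
    rw [mul_one_div, le_div_iff₀ hn0] at this
    linarith
  have hNle : N ≤ 4 * (α * L) + 1 + c := by
    have hlt : (arm₂ α ε).1 ⬝ᵥ e₁ < (arm₁ α ε).1 ⬝ᵥ e₁ := by simp [arm₁, arm₂, e₁]
    have h3 := integral_actionCount_le hα0.le hopt hell n hlt
    have h4 : (arm₁ α ε).1 ⬝ᵥ e₁ - (arm₂ α ε).1 ⬝ᵥ e₁ = 1 := by simp [arm₁, arm₂, e₁]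
    rw [h4, one_pow, div_one] at h3
    linarith
  -- A play of `x` gives `(8αεδ)² / 2` for regret `ε`, that is `δ²/2 * 64α²ε` per unit of regret;
  -- plays of `(0, 1)` are counted by `N`.
  have hI : ∫ h : History (arms α ε) n, ∑ s, ((h s).1.1 ⬝ᵥ (θ' - e₁)) ^ 2 / 2 ∂(law (π n) e₁ n) ≤
      δ ^ 2 / 2 * (N + 64 * α ^ 2 * ε * R) := by
    have i1 := integrable_sum_action (π n) e₁ n
      (({arm₂ α ε} : Set (arms α ε)).indicator fun _ => (1 : ℝ))
    have i2 := integrable_sum_action (π n) e₁ n fun a => gap (arms α ε) e₁ a.1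
    rw [hN, hR, regret, ← integral_const_mul (64 * α ^ 2 * ε),
      ← integral_add (by exact i1) (i2.const_mul _), ← integral_const_mul]
    refine integral_mono (integrable_sum_action (π n) e₁ n
      fun a => (a.1 ⬝ᵥ (θ' - e₁)) ^ 2 / 2) ((Integrable.add (by exact i1) (i2.const_mul _)).const_mul _)
      fun h => ?_
    simp only [actionCount]
    rw [Finset.mul_sum, ← Finset.sum_add_distrib, Finset.mul_sum]
    refine Finset.sum_le_sum fun s _ => ?_
    rw [hsub, gap_arms hε]
    obtain hs | hs | hs := eq_arm_cases (h s).1 <;> rw [hs]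
    · simp [arm₁_ne_arm₂]; simp [arm₁]
    · simp [arm₂]; nlinarith [mul_nonneg (sq_nonneg δ) (mul_nonneg (sq_nonneg α) hε.le)]
    · simp [(arm₂_ne_arm₃ hε1).symm]; simp [arm₃]
      apply le_of_eq; ring
  have h5 : 3 / 4 * L ≤ δ ^ 2 / 2 * (4 * (α * L) + 1 + c + 64 * α ^ 2 * ε * R) :=
    h1.trans (hI.trans (by gcongr))
  -- The information that optimism allows from `(0, 1)` stays below the required `3/4 L`. This uses
  -- `α ≥ 1/8`, through `δ ≤ 5/4`.
  have h6 : δ ^ 2 / 2 * (4 * (α * L)) ≤ 25 / 64 * L := by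
    have h7 : δ ^ 2 / 2 * (4 * (α * L)) = 2 * (α * δ) * δ * L := by ring
    have h8 : δ ≤ 5 / 4 := by
      rw [hδ, div_le_iff₀ (by positivity)]; linarith
    rw [h7, hαδ]
    gcongr
    linarith
  have h7 : δ ^ 2 / 2 * (64 * α ^ 2 * ε * R) = 25 / 32 * (ε * R) := by
    have : δ ^ 2 / 2 * (64 * α ^ 2 * ε * R) = 32 * (α * δ) ^ 2 * (ε * R) := by ring
    rw [this, hαδ]; ring
  rw [le_div_iff₀ hL0, div_mul_eq_mul_div, div_le_iff₀ hε]
  nlinarith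

/-! ### The optimal allocation problem -/

lemma allocMatrix_arms_mulVec (hε : 0 < ε) (hε1 : ε < 1) (w : arms α ε → ℝ) (v : Fin 2 → ℝ) :
    allocMatrix w *ᵥ v = (w (arm₁ α ε) * v 0) • (arm₁ α ε).1 +
      ((w (arm₂ α ε) * v 1) • (arm₂ α ε).1 +
      (w (arm₃ α ε) * ((1 - ε) * v 0 + 8 * α * ε * v 1)) • (arm₃ α ε).1) := by
  rw [allocMatrix, sum_arms hε hε1]
  ext i
  fin_cases i <;>
    simp [arm₁, arm₂, arm₃, mulVec, dotProduct, Fin.sum_univ_two] <;> ring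

/-- Every feasible allocation collects enough information in the direction of `e₂`. -/
lemma le_of_mem_feasible (hα : 0 < α) (hε : 0 < ε) (hε1 : ε < 1) {w : arms α ε → ℝ}
    (hw : w ∈ feasible (arms α ε) e₁) :
    128 * α ^ 2 ≤ w (arm₂ α ε) + (8 * α * ε) ^ 2 * w (arm₃ α ε) := by
  obtain ⟨hw0, hunit, hle⟩ := hw
  have h3 := hle (arm₃ α ε) (by rw [gap_arms hε]; simpa [arm₃] using hε)
  rw [gap_arms hε] at h3
  set u := (allocMatrix w)⁻¹ *ᵥ (arm₃ α ε).1 with hu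
  have hHu : allocMatrix w *ᵥ u = (arm₃ α ε).1 := by
    rw [hu, mulVec_mulVec, Matrix.mul_nonsing_inv _ ((Matrix.isUnit_iff_isUnit_det _).1 hunit),
      one_mulVec]
  rw [allocMatrix_arms_mulVec hε hε1] at hHu
  have e0 := congrFun hHu 0
  have e1 := congrFun hHu 1
  have v1 : (arm₁ α ε).1 = ![1, 0] := rfl
  have v2 : (arm₂ α ε).1 = ![0, 1] := rfl
  have v3 : (arm₃ α ε).1 = ![1 - ε, 8 * α * ε] := rfl
  simp [v1, v2, v3] at e0 e1
  have h4 : (1 - ε) * u 0 + 8 * α * ε * u 1 ≤ ε ^ 2 / 2 := by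
    simpa [arm₃, dotProduct, Fin.sum_univ_two] using h3
  have p1 := hw0 (arm₁ α ε)
  have p2 := hw0 (arm₂ α ε)
  have p3 := hw0 (arm₃ α ε)
  set w₁ := w (arm₁ α ε)
  set w₂ := w (arm₂ α ε)
  set w₃ := w (arm₃ α ε)
  set b := 8 * α * ε with hb
  set z := (1 - ε) * u 0 + b * u 1 with hz
  have hb0 : 0 < b := by positivity
  -- Cauchy-Schwarz applied to the second coordinate of `H u = x`, in which `w₁` does not occur. The
  -- first factor is then at most `uᵀ H u = z`, which feasibility bounds by `ε² / 2`.
  have hcs : b ^ 2 ≤ (w₂ * u 1 ^ 2 + w₃ * z ^ 2) * (w₂ + b ^ 2 * w₃) := by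
    have : b = w₂ * u 1 + w₃ * z * b := by linarith
    calc b ^ 2 = (w₂ * u 1 + w₃ * z * b) ^ 2 := by rw [← this]
      _ ≤ _ := by nlinarith [mul_nonneg (mul_nonneg p2 p3) (sq_nonneg (u 1 * b - z))]
  have hquad : w₂ * u 1 ^ 2 + w₃ * z ^ 2 ≤ z := by
    have : z = w₁ * u 0 ^ 2 + w₂ * u 1 ^ 2 + w₃ * z ^ 2 := by
      linear_combination (-u 0) * e0 + (-u 1) * e1
    nlinarith [mul_nonneg p1 (sq_nonneg (u 0))]
  have hS : 0 ≤ w₂ + b ^ 2 * w₃ := by positivity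
  have hfin : b ^ 2 ≤ ε ^ 2 / 2 * (w₂ + b ^ 2 * w₃) :=
    hcs.trans (mul_le_mul_of_nonneg_right (hquad.trans h4) hS)
  have hb2 : b ^ 2 = ε ^ 2 / 2 * (128 * α ^ 2) := by rw [hb]; ring
  rw [hb2] at hfin hS ⊢
  exact le_of_mul_le_mul_left hfin (by positivity)

/-- The allocation `(M, m, 0)`. -/
noncomputable def diagAlloc (α ε M m : ℝ) (a : arms α ε) : ℝ :=
  ({arm₁ α ε} : Set (arms α ε)).indicator (fun _ => M) a +
    ({arm₂ α ε} : Set (arms α ε)).indicator (fun _ => m) a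

/-- For `m > 128α²` the second coordinate of `x` leaves a slack `τ > 0` in its constraint, and
weight `τ⁻¹` on the free action `(1, 0)` fits the first coordinate into it. The constraint of `(0,
1)` is `m ≥ 2`, whence `α ≥ 1/8`. -/
lemma diagAlloc_mem_feasible (hα : 1 / 8 ≤ α) (hε : 0 < ε) (hε1 : ε < 1) {m : ℝ}
    (hm : 128 * α ^ 2 < m) : ∃ M, diagAlloc α ε M m ∈ feasible (arms α ε) e₁ := by
  have hm2 : 2 < m := by nlinarith
  have hm0 : 0 < m := by linarith
  have hτ : 0 < ε ^ 2 / 2 - (8 * α * ε) ^ 2 / m := by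
    have : (8 * α * ε) ^ 2 / m < ε ^ 2 / 2 := by
      rw [div_lt_iff₀ hm0]
      nlinarith [pow_pos hε 2]
    linarith
  set τ := ε ^ 2 / 2 - (8 * α * ε) ^ 2 / m with hτdef
  refine ⟨τ⁻¹, ?_, ?_⟩
  · intro a
    exact add_nonneg (Set.indicator_nonneg (fun _ _ => by positivity) _)
      (Set.indicator_nonneg (fun _ _ => hm0.le) _)
  have d1 : diagAlloc α ε τ⁻¹ m (arm₁ α ε) = τ⁻¹ := by simp [diagAlloc, arm₁_ne_arm₂]
  have d2 : diagAlloc α ε τ⁻¹ m (arm₂ α ε) = m := by simp [diagAlloc, arm₁_ne_arm₂.symm]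
  have d3 : diagAlloc α ε τ⁻¹ m (arm₃ α ε) = 0 := by
    simp [diagAlloc, (arm₁_ne_arm₃ hε).symm, (arm₂_ne_arm₃ hε1).symm]
  have hH : allocMatrix (diagAlloc α ε τ⁻¹ m) = diagonal ![τ⁻¹, m] := by
    rw [allocMatrix, sum_arms hε hε1, d1, d2, d3]
    ext i j
    fin_cases i <;> fin_cases j <;> simp [arm₁, arm₂]
  have hinv : (diagonal ![τ⁻¹, m])⁻¹ = diagonal ![τ, m⁻¹] := by
    refine Matrix.inv_eq_right_inv ?_
    rw [diagonal_mul_diagonal, ← diagonal_one]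
    congr 1
    ext i
    fin_cases i
    · simp [hτ.ne']
    · simp [hm0.ne']
  refine ⟨?_, fun a ha => ?_⟩
  · rw [hH, Matrix.isUnit_iff_isUnit_det, det_diagonal, Fin.prod_univ_two, isUnit_iff_ne_zero]
    simp [hτ.ne', hm0.ne']
  · rw [hH, hinv, gap_arms hε]
    rw [gap_arms hε] at ha
    obtain rfl | rfl | rfl := eq_arm_cases a
    · simp [arm₁] at ha
    · simp [arm₂, dotProduct, mulVec_diagonal, Fin.sum_univ_two]
      rw [inv_eq_one_div, inv_eq_one_div]
      exact one_div_le_one_div_of_le two_pos hm2.le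
    · simp only [arm₃, dotProduct, mulVec_diagonal, Fin.sum_univ_two, cons_val_zero, cons_val_one]
      have h1 : 8 * α * ε * (m⁻¹ * (8 * α * ε)) = ε ^ 2 / 2 - τ := by
        rw [hτdef]; ring
      rw [h1]
      have h2 : (1 - ε) * (1 - ε) ≤ 1 := by nlinarith
      nlinarith

/-- The cost is `w₂ + ε w₃`, and `64α²ε ≤ 1` makes it at least the information `w₂ + (8αε)² w₃`: `x`
is no cheaper a source than `(0, 1)`. The upper bound lets `m` decrease to `128α²`, where `τ`
vanishes. -/
lemma optConst_arms (hα : 1 / 8 ≤ α) (hε : 0 < ε) (hε1 : ε < 1) (hεα : 64 * α ^ 2 * ε ≤ 1) :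
    optConst (arms α ε) e₁ = ((128 * α ^ 2 : ℝ) : EReal) := by
  have hα0 : 0 < α := by linarith
  have hcost : ∀ w : arms α ε → ℝ, ∑ a : arms α ε, w a * gap (arms α ε) e₁ a.1 =
      w (arm₂ α ε) + ε * w (arm₃ α ε) := fun w => by
    simp only [gap_arms hε]
    rw [sum_arms hε hε1]
    simp [arm₁, arm₂, arm₃]
    ring
  refine le_antisymm ?_ (le_iInf₂ fun w hw => ?_)
  · refine EReal.le_of_forall_lt_iff_le.1 fun m hm => ?_
    obtain ⟨M, hM⟩ := diagAlloc_mem_feasible hα hε hε1 (EReal.coe_lt_coe_iff.1 hm)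
    refine (iInf₂_le _ hM).trans ?_
    rw [EReal.coe_le_coe_iff, hcost]
    simp [diagAlloc, arm₁_ne_arm₂.symm, (arm₁_ne_arm₃ hε).symm, (arm₂_ne_arm₃ hε1).symm]
  · rw [EReal.coe_le_coe_iff, hcost]
    refine (le_of_mem_feasible hα0 hε hε1 hw).trans ?_
    have := mul_le_mul_of_nonneg_right hεα (mul_nonneg hε.le (hw.1 (arm₃ α ε)))
    nlinarith

lemma ne_zero_of_mem_arms (hα : 0 < α) (hε : 0 < ε) : ∀ a ∈ arms α ε, a ≠ 0 := by
  intro a ha h0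
  have e0 := congrFun h0 0
  have e1 := congrFun h0 1
  obtain rfl | rfl | rfl := mem_arms.1 ha
  · simp at e0
  · simp at e1
  · simp [hα.ne', hε.ne'] at e1

lemma optConst_eq_and_le_asympRegret (hα : 0 < α) (hε : 0 < ε) (hε1 : ε < 1)
    (hεα : 64 * α ^ 2 * ε ≤ 1) {π : ℕ → Policy (arms α ε)}
    (hπ : IsOptimisticAlgorithm α e₁ π) :
    optConst (arms α ε) e₁ = ((128 * α ^ 2 : ℝ) : EReal) ∧
      ((1 / 4 / ε : ℝ) : EReal) ≤ asympRegret π e₁ := by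
  have hα1 : 1 / 8 ≤ α := by
    linarith [one_le_of_isOptimisticAlgorithm hα.le (ne_zero_of_mem_arms hα hε) hπ]
  refine ⟨optConst_arms hα1 hε hε1 hεα, ?_⟩
  refine le_limsup_of_frequently_le (Eventually.frequently ?_)
  filter_upwards [eventually_le_regret hα1 hε hε1 hπ] with n hn
  exact EReal.coe_le_coe_iff.2 hn

end Instance

end LinearBandit

/-! ### The three claims -/

open LinearBandit in
theorem mainTheorem5 :
    -- the constant of the instance
    (∀ α : ℝ, 1 / 8 ≤ α → ∃ ε₀ : ℝ, 0 < ε₀ ∧ ∀ ε : ℝ, 0 < ε → ε < ε₀ →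
      optConst (arms α ε) e₁ = ((128 * α ^ 2 : ℝ) : EReal)) ∧
    -- the regret of optimistic algorithms
    (∃ c : ℝ, 0 < c ∧ ∀ α : ℝ, 0 < α → ∃ ε₀ : ℝ, 0 < ε₀ ∧ ∀ ε : ℝ, 0 < ε → ε < ε₀ →
      ∀ π : ℕ → Policy (arms α ε), IsOptimisticAlgorithm α e₁ π →
        optConst (arms α ε) e₁ = ((128 * α ^ 2 : ℝ) : EReal) ∧
        ((c / ε : ℝ) : EReal) ≤ asympRegret π e₁) ∧
    -- sub-optimality by an arbitrarily large factor
    (∀ α : ℝ, 0 < α → ∀ K : ℝ, 0 < K → ∃ ε₀ : ℝ, 0 < ε₀ ∧ ∀ ε : ℝ, 0 < ε → ε < ε₀ →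
      ∀ π : ℕ → Policy (arms α ε), IsOptimisticAlgorithm α e₁ π →
        (K : EReal) * optConst (arms α ε) e₁ ≤ asympRegret π e₁) := by
  have hsmall : ∀ α ε : ℝ, 0 < α → ε < min 1 (64 * α ^ 2)⁻¹ → ε < 1 ∧ 64 * α ^ 2 * ε ≤ 1 := by
    intro α ε hα h
    have h1 : 0 < 64 * α ^ 2 := by positivity
    refine ⟨h.trans_le (min_le_left _ _), ?_⟩
    have h2 := (h.trans_le (min_le_right _ _)).le
    rwa [← one_div, le_div_iff₀' h1] at h2
  have hpos : ∀ α : ℝ, 0 < α → 0 < min 1 (64 * α ^ 2)⁻¹ := fun α hα => by positivity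
  refine ⟨fun α hα => ?_, ⟨1 / 4, by norm_num, fun α hα => ?_⟩, fun α hα K hK => ?_⟩
  · have hα0 : 0 < α := by linarith
    refine ⟨_, hpos α hα0, fun ε hε h => ?_⟩
    obtain ⟨h1, h2⟩ := hsmall α ε hα0 h
    exact optConst_arms hα hε h1 h2
  · refine ⟨_, hpos α hα, fun ε hε h π hπ => ?_⟩
    obtain ⟨h1, h2⟩ := hsmall α ε hα h
    exact optConst_eq_and_le_asympRegret hα hε h1 h2 hπ
  -- The last term makes `1 / (4ε)` exceed `K * 128α²`.
  · refine ⟨min (min 1 (64 * α ^ 2)⁻¹) (1 / 4 / (K * (128 * α ^ 2))),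
      lt_min (hpos α hα) (by positivity), fun ε hε h π hπ => ?_⟩
    obtain ⟨h1, h2⟩ := hsmall α ε hα (h.trans_le (min_le_left _ _))
    obtain ⟨h3, h4⟩ := optConst_eq_and_le_asympRegret hα hε h1 h2 hπ
    rw [h3, ← EReal.coe_mul]
    refine le_trans (EReal.coe_le_coe_iff.2 ?_) h4
    have h5 := h.trans_le (min_le_right _ _)
    rw [lt_div_iff₀ (by positivity)] at h5
    rw [le_div_iff₀ hε]
    linarith
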